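/- Let $n,r$ be natural numbers, $[r]=\{1,\dots,r\}$, and let $A=(a_{ij})_{1\le i\le n,\,1\le j\le r}$ be a real matrix with non-negative entries which has at least one positive entry in each row and in each column. The Shintani zeta function associated to $A$ is given by the series $$\zeta_A(\boldsymbol s)=\sum_{m_1\ge 1}\cdots\sum_{m_r\ge 1}\ \prod_{i=1}^n (a_{i1}m_1+\cdots+a_{ir}m_r)^{-s_i},\qquad \boldsymbol s=(s_1,\dots,s_n)\in\mathbb C^n.$$ For $j\in[r]$ let $C_j(\boldsymbol\epsilon)=\sum_{i=1}^n a_{ij}\epsilon_i$ be the linear form given by the $j$-th column of $A$, and for $I\subset[r]$ let $C_I=\prod_{j\in I}C_j$ (so $C_\emptyset=1$). For a polynomial $p$ in $n$ variables let $\Delta_p\subset\mathbb R^n$ be its Newton polytope, i.e. the convex hull of the exponents of the monomials that occur in $p$ with a nonzero coefficient, and let $\mathbb R^n_+=\{x\in\mathbb R^n: x_i>0\text{ for all }i\}$. If $$(\operatorname{Re}s_1,\dots,\operatorname{Re}s_n)\in\bigcap_{I\subset[r]}\bigl(\Delta_{C_I}+\mathbb R^n_+\bigr)$$ (Minkowski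 sums), then the series defining $\zeta_A(\boldsymbol s)$ is absolutely convergent. -/

import Mathlib

open scoped Pointwise

noncomputable section

/-- The set `Σ_{n×r}(ℝ_{≥0})` of `n × r` matrices with real non-negative entries and with at least
one positive entry in each row and in each column. -/
def shintaniMatrices (n r : ℕ) : Set (Matrix (Fin n) (Fin r) ℝ) :=
  {A | (∀ i j, 0 ≤ A i j) ∧ (∀ i, ∃ j, 0 < A i j) ∧ (∀ j, ∃ i, 0 < A i j)}

/-- The summand of index `m = (m₁, …, m_r)`, `m_j ≥ 1`, of the Shintani zeta function
`ζ_A(s) = ∑_m ∏_i (a_{i1} m₁ + ⋯ + a_{ir} m_r)^{-s_i}`. -/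
def shintaniTerm {n r : ℕ} (A : Matrix (Fin n) (Fin r) ℝ) (s : Fin n → ℂ)
    (m : Fin r → ℕ+) : ℂ :=
  ∏ i, ((∑ j, A i j * ((m j : ℕ) : ℝ) : ℝ) : ℂ) ^ (-s i)

/-- The linear form `C_j(ε) = ∑_i a_{ij} ε_i` of the `j`-th column of `A`, as a polynomial. -/
def columnForm {n r : ℕ} (A : Matrix (Fin n) (Fin r) ℝ) (j : Fin r) : MvPolynomial (Fin n) ℝ :=
  ∑ i, MvPolynomial.C (A i j) * MvPolynomial.X i

/-- The product `C_I = ∏_{j ∈ I} C_j` (so `C_∅ = 1`). -/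
def columnProduct {n r : ℕ} (A : Matrix (Fin n) (Fin r) ℝ) (I : Finset (Fin r)) :
    MvPolynomial (Fin n) ℝ :=
  ∏ j ∈ I, columnForm A j

/-- The Newton polytope `Δ_p ⊆ ℝⁿ`: the convex hull of the exponents of the monomials that occur
in `p` with a nonzero coefficient. -/
def newtonPolytope {n : ℕ} (p : MvPolynomial (Fin n) ℝ) : Set (Fin n → ℝ) :=
  convexHull ℝ ((fun (α : Fin n →₀ ℕ) (i : Fin n) => (α i : ℝ)) '' (p.support : Set (Fin n →₀ ℕ)))

/-- The open positive orthant `ℝⁿ_+`. -/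
def positiveOrthant (n : ℕ) : Set (Fin n → ℝ) :=
  {x | ∀ i, 0 < x i}

end

/-! Write L_i for the i-th linear form and σ_i = Re s_i. By the condition for I = [r], σ is a point
of the Newton polytope of ∏_j C_j plus a positive vector δ. That point is the vector of row sums of
a non-negative matrix supported where A is, with column sums 1
(`newtonPolytope_columnProduct_univ_subset`). Spreading δ over the support gives weights w with
column sums > 1 and row sums ≤ σ_i (`exists_weights`). Since L_i ≥ a_ij m_j and L_i is bounded below
by a positive constant, L_i^(-σ_i) is at most a constant times ∏_j m_j^(-w_ij)
(`exists_rpow_linearForm_le`). Multiplying over i, the series is dominated by a product of r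
one-variable series ∑ m^(-p) with p > 1. -/

/-- Every exponent of `∏_j C_j` arises by choosing, for each column `j`, a row `f j` with
`a_{f(j), j} ≠ 0`. -/
theorem exists_selection_of_mem_support {n r : ℕ} (A : Matrix (Fin n) (Fin r) ℝ)
    {α : Fin n →₀ ℕ} (hα : α ∈ (columnProduct A Finset.univ).support) :
    ∃ f : Fin r → Fin n, (∀ j, A (f j) j ≠ 0) ∧ α = ∑ j, Finsupp.single (f j) 1 := by
  classical
  have hexp : columnProduct A Finset.univ =
      ∑ f : Fin r → Fin n, MvPolynomial.monomial (∑ j, Finsupp.single (f j) 1)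
        (∏ j, A (f j) j) := by
    unfold columnProduct columnForm
    rw [Finset.prod_univ_sum, Fintype.piFinset_univ]
    refine Finset.sum_congr rfl fun f _ => ?_
    rw [MvPolynomial.monomial_sum_index, Finset.prod_mul_distrib, map_prod]
    rfl
  -- A nonzero coefficient forces at least one choice function to contribute a nonzero term.
  rw [MvPolynomial.mem_support_iff, hexp, MvPolynomial.coeff_sum] at hα
  obtain ⟨f, -, hf⟩ := Finset.exists_ne_zero_of_sum_ne_zero hα
  rw [MvPolynomial.coeff_monomial] at hf
  split_ifs at hf with h
  · exact ⟨f, fun j => Finset.prod_ne_zero_iff.mp hf j (Finset.mem_univ j), h.symm⟩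
  · exact absurd rfl hf

/-- The row sums of the non-negative matrices that are supported where `A` is and whose columns
all sum to `1`. -/
def fractionalSelections {n r : ℕ} (A : Matrix (Fin n) (Fin r) ℝ) : Set (Fin n → ℝ) :=
  {x | ∃ w : Fin n → Fin r → ℝ, (∀ i j, 0 ≤ w i j) ∧ (∀ i j, A i j = 0 → w i j = 0) ∧
    (∀ j, ∑ i, w i j = 1) ∧ ∀ i, x i = ∑ j, w i j}

theorem convex_fractionalSelections {n r : ℕ} (A : Matrix (Fin n) (Fin r) ℝ) :
    Convex ℝ (fractionalSelections A) := by
  rintro x ⟨v, hv0, hvA, hv1, hvx⟩ y ⟨w, hw0, hwA, hw1, hwy⟩ a b ha hb hab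
  refine ⟨fun i j => a * v i j + b * w i j, fun i j => ?_, fun i j h => ?_, fun j => ?_,
    fun i => ?_⟩
  · have := hv0 i j
    have := hw0 i j
    positivity
  · simp [hvA i j h, hwA i j h]
  · rw [Finset.sum_add_distrib, ← Finset.mul_sum, ← Finset.mul_sum, hv1, hw1]
    linarith
  · rw [Finset.sum_add_distrib, ← Finset.mul_sum, ← Finset.mul_sum, ← hvx, ← hwy]
    simp

/-- A choice of one row per column is a 0/1 matrix with column sums 1, and its row sums form the
exponent. Convexity extends this from the exponents to their hull. -/
theorem newtonPolytope_columnProduct_univ_subset {n r : ℕ} (A : Matrix (Fin n) (Fin r) ℝ) :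
    newtonPolytope (columnProduct A Finset.univ) ⊆ fractionalSelections A := by
  classical
  refine convexHull_min ?_ (convex_fractionalSelections A)
  rintro _ ⟨α, hα, rfl⟩
  obtain ⟨f, hf, rfl⟩ := exists_selection_of_mem_support A hα
  refine ⟨fun i j => if f j = i then 1 else 0, fun i j => ?_, fun i j h => ?_, fun j => ?_,
    fun i => ?_⟩
  · dsimp only
    split_ifs <;> norm_num
  · refine if_neg fun hij => hf j ?_
    rw [hij, h]
  · simp
  · simp [Finsupp.finsetSum_apply, Finsupp.single_apply]

/-- A product of non-negative summable functions in separate variables is summable. -/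
theorem summable_pi_prod {ι κ : Type*} [Fintype ι] (f : ι → κ → ℝ)
    (h0 : ∀ j k, 0 ≤ f j k) (hf : ∀ j, Summable (f j)) :
    Summable fun m : ι → κ => ∏ j, f j (m j) := by
  classical
  refine summable_of_sum_le (c := ∏ j, ∑' k, f j k)
    (fun m => Finset.prod_nonneg fun j _ => h0 j _) fun u => ?_
  calc ∑ m ∈ u, ∏ j, f j (m j)
      ≤ ∑ m ∈ Fintype.piFinset fun j => u.image fun m => m j, ∏ j, f j (m j) := by
        refine Finset.sum_le_sum_of_subset_of_nonneg (fun m hm => ?_)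
          fun m _ _ => Finset.prod_nonneg fun j _ => h0 j _
        exact Fintype.mem_piFinset.mpr fun j => Finset.mem_image_of_mem _ hm
    _ = ∏ j, ∑ k ∈ u.image fun m => m j, f j k := (Finset.prod_univ_sum _ _).symm
    _ ≤ ∏ j, ∑' k, f j k := Finset.prod_le_prod
        (fun j _ => Finset.sum_nonneg fun k _ => h0 j k)
        fun j _ => (hf j).sum_le_tsum _ fun k _ => h0 j k

/-- Exponent weights on the entries of `A` whose row sums are at most `σ` and whose column sums
exceed `1`. -/
theorem exists_weights {n r : ℕ} {A : Matrix (Fin n) (Fin r) ℝ} (hA : A ∈ shintaniMatrices n r)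
    {σ : Fin n → ℝ}
    (hσ : σ ∈ newtonPolytope (columnProduct A Finset.univ) + positiveOrthant n) :
    ∃ w : Fin n → Fin r → ℝ, (∀ i j, 0 ≤ w i j) ∧ (∀ i j, A i j = 0 → w i j = 0) ∧
      (∀ j, 1 < ∑ i, w i j) ∧ ∀ i, ∑ j, w i j ≤ σ i := by
  classical
  obtain ⟨x, hx, δ, hδ, rfl⟩ := Set.mem_add.mp hσ
  obtain ⟨v, hv0, hvA, hv1, hvx⟩ := newtonPolytope_columnProduct_univ_subset A hx
  have hδ' : ∀ i, 0 < δ i := hδ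
  -- Row i has at most r nonzero entries, so it gains at most `δ i`; each column has a nonzero
  -- entry, so its sum rises strictly above 1.
  refine ⟨fun i j => v i j + if A i j = 0 then 0 else δ i / r, fun i j => ?_, fun i j h => ?_,
    fun j => ?_, fun i => ?_⟩
  · have := hv0 i j
    have := hδ' i
    dsimp only
    split_ifs <;> positivity
  · simp [hvA i j h, h]
  · rw [Finset.sum_add_distrib, hv1]
    obtain ⟨i, hi⟩ := hA.2.2 j
    have hr : (0 : ℝ) < r := by exact_mod_cast j.pos
    refine lt_add_of_pos_right _ (Finset.sum_pos' (fun i _ => ?_) ⟨i, Finset.mem_univ i, ?_⟩)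
    · have := hδ' i
      split_ifs <;> positivity
    · rw [if_neg hi.ne']
      exact div_pos (hδ' i) hr
  · obtain ⟨j, -⟩ := hA.2.1 i
    have hr : (r : ℝ) ≠ 0 := by exact_mod_cast j.pos.ne'
    rw [Finset.sum_add_distrib, Pi.add_apply, hvx]
    refine add_le_add le_rfl ?_
    calc ∑ j, (if A i j = 0 then 0 else δ i / r) ≤ ∑ _j : Fin r, δ i / r := by
          refine Finset.sum_le_sum fun j _ => ?_
          have := hδ' i
          split_ifs
          · positivity
          · exact le_rfl
      _ = δ i := by
          rw [Finset.sum_const, Finset.card_univ, Fintype.card_fin, nsmul_eq_mul]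
          field_simp

/-- A power of a positive linear form is bounded by a product of powers of its variables. -/
theorem exists_rpow_linearForm_le {r : ℕ} {a : Fin r → ℝ} (ha : ∀ j, 0 ≤ a j)
    (hpos : ∃ j, 0 < a j) {w : Fin r → ℝ} (hw : ∀ j, 0 ≤ w j) (hwa : ∀ j, a j = 0 → w j = 0)
    {σ : ℝ} (hσ : ∑ j, w j ≤ σ) :
    ∃ C : ℝ, 0 ≤ C ∧ ∀ m : Fin r → ℕ+,
      (∑ j, a j * ((m j : ℕ) : ℝ)) ^ (-σ) ≤ C * ∏ j, ((m j : ℕ) : ℝ) ^ (-w j) := by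
  obtain ⟨k, hk⟩ := hpos
  -- The surplus exponent σ - ∑ w_j ≥ 0 is absorbed by L ≥ a_k, and each L^(-w_j) by L ≥ a_j m_j.
  refine ⟨a k ^ (-(σ - ∑ j, w j)) * ∏ j, a j ^ (-w j), mul_nonneg (Real.rpow_nonneg hk.le _)
    (Finset.prod_nonneg fun j _ => Real.rpow_nonneg (ha j) _), fun m => ?_⟩
  have hm : ∀ j, (1 : ℝ) ≤ ((m j : ℕ) : ℝ) := fun j => by exact_mod_cast (m j).pos
  have hle : ∀ j, a j * ((m j : ℕ) : ℝ) ≤ ∑ j, a j * ((m j : ℕ) : ℝ) := fun j =>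
    Finset.single_le_sum (f := fun j => a j * ((m j : ℕ) : ℝ))
      (fun l _ => mul_nonneg (ha l) (Nat.cast_nonneg _)) (Finset.mem_univ j)
  have hkL := (le_mul_of_one_le_right hk.le (hm k)).trans (hle k)
  set L := ∑ j, a j * ((m j : ℕ) : ℝ)
  have hL : 0 < L := hk.trans_le hkL
  have hsplit : L ^ (-σ) = L ^ (-(σ - ∑ j, w j)) * ∏ j, L ^ (-w j) := by
    rw [← Real.rpow_sum_of_pos hL, ← Real.rpow_add hL, Finset.sum_neg_distrib]
    congr 1
    ring
  rw [hsplit, mul_assoc, ← Finset.prod_mul_distrib]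
  refine mul_le_mul (Real.rpow_le_rpow_of_nonpos hk hkL (by linarith))
    (Finset.prod_le_prod (fun j _ => Real.rpow_nonneg hL.le _) fun j _ => ?_)
    (Finset.prod_nonneg fun j _ => Real.rpow_nonneg hL.le _) (Real.rpow_nonneg hk.le _)
  rcases (ha j).eq_or_lt with h | h
  -- If a_j = 0 then w_j = 0, and every power involved, including 0^0, equals 1.
  · simp [hwa j h.symm]
  · rw [← Real.mul_rpow h.le (Nat.cast_nonneg _)]
    exact Real.rpow_le_rpow_of_nonpos (mul_pos h (zero_lt_one.trans_le (hm j))) (hle j)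
      (neg_nonpos.mpr (hw j))

theorem norm_shintaniTerm {n r : ℕ} {A : Matrix (Fin n) (Fin r) ℝ}
    (hA : A ∈ shintaniMatrices n r) (s : Fin n → ℂ) (m : Fin r → ℕ+) :
    ‖shintaniTerm A s m‖ = ∏ i, (∑ j, A i j * ((m j : ℕ) : ℝ)) ^ (-(s i).re) := by
  unfold shintaniTerm
  rw [norm_prod]
  refine Finset.prod_congr rfl fun i _ => ?_
  obtain ⟨j, hj⟩ := hA.2.1 i
  rw [Complex.norm_cpow_eq_rpow_re_of_pos, Complex.neg_re]
  exact Finset.sum_pos' (fun l _ => mul_nonneg (hA.1 i l) (Nat.cast_nonneg _))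
    ⟨j, Finset.mem_univ j, mul_pos hj (by exact_mod_cast (m j).pos)⟩

theorem mainTheorem8 (n r : ℕ) (A : Matrix (Fin n) (Fin r) ℝ) (hA : A ∈ shintaniMatrices n r)
    (s : Fin n → ℂ)
    (hs : (fun i => (s i).re) ∈
      ⋂ I : Finset (Fin r), (newtonPolytope (columnProduct A I) + positiveOrthant n)) :
    Summable (fun m : Fin r → ℕ+ => ‖shintaniTerm A s m‖) := by
  obtain ⟨w, hw0, hwA, hw1, hwσ⟩ := exists_weights hA (Set.mem_iInter.mp hs Finset.univ)
  choose C hC0 hC using fun i =>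
    exists_rpow_linearForm_le (hA.1 i) (hA.2.1 i) (hw0 i) (hwA i) (hwσ i)
  have hsum : Summable fun m : Fin r → ℕ+ => ∏ j, ((m j : ℕ) : ℝ) ^ (-∑ i, w i j) := by
    refine summable_pi_prod (fun j (k : ℕ+) => ((k : ℕ) : ℝ) ^ (-∑ i, w i j))
      (fun j k => Real.rpow_nonneg (Nat.cast_nonneg _) _) fun j => ?_
    exact (Real.summable_nat_rpow.mpr (neg_lt_neg (hw1 j))).comp_injective PNat.coe_injective
  refine Summable.of_nonneg_of_le (fun _ => norm_nonneg _) (fun m => ?_)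
    (hsum.mul_left (∏ i, C i))
  rw [norm_shintaniTerm hA]
  calc ∏ i, (∑ j, A i j * ((m j : ℕ) : ℝ)) ^ (-(s i).re)
      ≤ ∏ i, (C i * ∏ j, ((m j : ℕ) : ℝ) ^ (-w i j)) := by
        refine Finset.prod_le_prod (fun i _ => Real.rpow_nonneg ?_ _) fun i _ => hC i m
        exact Finset.sum_nonneg fun j _ => mul_nonneg (hA.1 i j) (Nat.cast_nonneg _)
    _ = (∏ i, C i) * ∏ j, ((m j : ℕ) : ℝ) ^ (-∑ i, w i j) := by
        -- Regrouping by columns collects the exponents of each m_j into a column sum of `w`.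
        rw [Finset.prod_mul_distrib, Finset.prod_comm]
        congr 1
        refine Finset.prod_congr rfl fun j _ => ?_
        rw [← Finset.sum_neg_distrib, Real.rpow_sum_of_pos (by exact_mod_cast (m j).pos)]
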